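/- For a positive integer $n$ let $m = \varphi(n)$ be Euler's totient of $n$, let $\zeta_{n,0}, \dots, \zeta_{n,m-1} \in \mathbb{C}$ be the primitive $n$th roots of unity (in any order), and let $V_n = \big(\zeta_{n,i}^{\,j}\big)_{0 \le i,j \le m-1} \in \mathbb{C}^{m \times m}$ be the Vandermonde matrix of the $n$th cyclotomic polynomial. For an invertible complex matrix $V$ put $\operatorname{Cond}(V) = \|V\|\,\|V^{-1}\|$, where $\|V\| = \sqrt{\operatorname{Tr}(V^* V)}$ is the Frobenius norm. Then there exist infinitely many positive integers $n$ such that $$\operatorname{Cond}(V_n) > \exp\!\big(n^{\log 2/\log\log n}\big)/\sqrt{n}.$$ In particular, for every fixed real $r > 0$, $\operatorname{Cond}(V_n) \neq O(n^r)$ as $n \to \infty$. -/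

import Mathlib

section CondNumber

open scoped Matrix.Norms.Frobenius

/-- The condition number `‖V‖ ‖V⁻¹‖` of a square complex matrix, where `‖·‖` is the Frobenius
norm. It is meaningful for invertible matrices only. -/
noncomputable def condNumber {k : ℕ} (V : Matrix (Fin k) (Fin k) ℂ) : ℝ :=
  ‖V‖ * ‖V⁻¹‖

/-- The Frobenius norm in `condNumber` is `√(Tr(V* V))`. -/
theorem condNumber_eq_sqrt_trace {k : ℕ} (V : Matrix (Fin k) (Fin k) ℂ) :
    condNumber V = Real.sqrt (Matrix.trace (V.conjTranspose * V)).re *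
      Real.sqrt (Matrix.trace ((V⁻¹).conjTranspose * V⁻¹)).re := by
  have key : ∀ A : Matrix (Fin k) (Fin k) ℂ,
      ‖A‖ = Real.sqrt (Matrix.trace (A.conjTranspose * A)).re := by
    intro A
    rw [Matrix.frobenius_norm_def, ← Real.sqrt_eq_rpow]
    congr 1
    simp only [Matrix.trace, Matrix.diag, Matrix.mul_apply, Matrix.conjTranspose_apply,
      Complex.re_sum]
    rw [Finset.sum_comm]
    refine Finset.sum_congr rfl fun i _ => Finset.sum_congr rfl fun j _ => ?_
    rw [RCLike.star_def, Complex.conj_mul', Real.rpow_two]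
    norm_cast
  rw [condNumber, key, key]

end CondNumber

/-- `ζ` lists the primitive `n`th roots of unity, each exactly once. (There are `φ(n)` of them,
so an injective list of length `φ(n)` contains all of them.) -/
def EnumeratesPrimitiveRoots (n : ℕ) (ζ : Fin (Nat.totient n) → ℂ) : Prop :=
  Function.Injective ζ ∧ ∀ i, IsPrimitiveRoot (ζ i) n

/-! ### Cyclotomic values as lower bounds for the condition number -/

section LowerBound

open scoped Matrix.Norms.Frobenius
open Polynomial

/-! The coefficients of `Φ_n` solve a linear system with matrix `V_n`, so a large value of `Φ_n` in
the unit disc forces a large condition number (`norm_eval_cyclotomic_le_condNumber_add_one`). Take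
`n` to be the product of the first `j` primes `≡ ±2 mod 5`. By `Φ_{mp}(z) = Φ_m(z^p) / Φ_m(z)`, each
new prime multiplies the log-ratio of `|Φ|` at `z ^ 2` and `z`, for `z` of order 5, by `-2`; hence
some `|Φ_n|` is at least `exp (2 ^ (j - 1) * c)`.

It remains to find infinitely many `j` with `j ≥ log n / log log n + C` (`frequently_sum_log_le`).
Otherwise `θ_j = log n` eventually exceeds `(j - C) log θ_j`, so the primes are on average as sparse
as `e * j * log j`, density about `1/e`. Convexity of `t ↦ t * exp (-s * t)` turns this into `∑ log
p / p ^ s ≤ 0.48 ζ(s) + O(1)`, while Dirichlet's theorem gives density `1/2`, a contradiction as `s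
→ 1⁺`. -/

theorem sum_norm_le_card_mul_frobenius_norm {k : ℕ} (A : Matrix (Fin k) (Fin k) ℂ) :
    ∑ i, ∑ j, ‖A i j‖ ≤ k * ‖A‖ := by
  have hA : ‖A‖ = Real.sqrt (∑ p : Fin k × Fin k, ‖A p.1 p.2‖ ^ 2) := by
    rw [Matrix.frobenius_norm_def, Real.sqrt_eq_rpow, Fintype.sum_prod_type]
    norm_cast
  rw [← Fintype.sum_prod_type' (f := fun i j => ‖A i j‖)]
  refine abs_le_of_sq_le_sq' ?_ (by positivity) |>.2
  rw [mul_pow, hA, Real.sq_sqrt (by positivity)]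
  refine sq_sum_le_card_mul_sum_sq.trans (le_of_eq ?_)
  simp [sq]

theorem frobenius_norm_of_norm_eq_one {k : ℕ} (A : Matrix (Fin k) (Fin k) ℂ)
    (hA : ∀ i j, ‖A i j‖ = 1) : ‖A‖ = k := by
  rw [Matrix.frobenius_norm_def, ← Real.sqrt_eq_rpow]
  simp [hA]

/-- All entries of `V` have modulus 1, so `‖V‖ = φ(n)`, exactly the factor that Cauchy–Schwarz costs
in bounding the entry sum of `V⁻¹` by its Frobenius norm. The `+ 1` is the monic leading term. -/
theorem norm_eval_cyclotomic_le_condNumber_add_one {n : ℕ} (hn : 0 < n)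
    {ζ : Fin (Nat.totient n) → ℂ} (hζ : EnumeratesPrimitiveRoots n ζ) {z : ℂ} (hz : ‖z‖ ≤ 1) :
    ‖(cyclotomic n ℂ).eval z‖ ≤ condNumber (Matrix.vandermonde ζ) + 1 := by
  obtain ⟨hinj, hprim⟩ := hζ
  set V := Matrix.vandermonde ζ with hV
  have hdet : IsUnit V.det := isUnit_iff_ne_zero.2 (Matrix.det_vandermonde_ne_zero_iff.2 hinj)
  have hnorm : ∀ i, ‖ζ i‖ = 1 := fun i => (hprim i).norm'_eq_one hn.ne'
  have heval : ∀ x : ℂ, (cyclotomic n ℂ).eval x =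
      (∑ j : Fin (Nat.totient n), (cyclotomic n ℂ).coeff j * x ^ (j : ℕ)) +
        x ^ Nat.totient n := by
    intro x
    have hc : (cyclotomic n ℂ).coeff (Nat.totient n) = 1 := by
      simpa [Monic, leadingCoeff, natDegree_cyclotomic] using cyclotomic.monic n ℂ
    rw [eval_eq_sum_range, natDegree_cyclotomic, Finset.sum_range_succ, hc, one_mul,
      Finset.sum_range]
  set d : Fin (Nat.totient n) → ℂ := fun j => (cyclotomic n ℂ).coeff j with hd
  -- `Φ_n (ζ i) = 0` expresses the lower-order terms through the leading one.
  have hVd : V.mulVec d = fun i => -(ζ i ^ Nat.totient n) := by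
    funext i
    have h := heval (ζ i)
    rw [((hprim i).isRoot_cyclotomic hn).eq_zero] at h
    rw [eq_neg_iff_add_eq_zero, h]
    simp [Matrix.mulVec, dotProduct, hV, Matrix.vandermonde_apply, hd, mul_comm]
  have hdW : d = V⁻¹.mulVec fun i => -(ζ i ^ Nat.totient n) := by
    rw [← hVd, Matrix.mulVec_mulVec, Matrix.nonsing_inv_mul _ hdet, Matrix.one_mulVec]
  have hdj : ∀ j, ‖d j‖ ≤ ∑ k, ‖V⁻¹ j k‖ := by
    intro j
    rw [hdW]
    rw [Matrix.mulVec, dotProduct]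
    refine (norm_sum_le _ _).trans (Finset.sum_le_sum fun k _ => ?_)
    simp [hnorm]
  have hVn : ‖V‖ = Nat.totient n :=
    frobenius_norm_of_norm_eq_one _ fun i j => by simp [hV, Matrix.vandermonde_apply, hnorm]
  rw [heval, condNumber, hVn]
  refine (norm_add_le _ _).trans (add_le_add ?_ ?_)
  · refine le_trans ?_ (sum_norm_le_card_mul_frobenius_norm V⁻¹)
    refine (norm_sum_le _ _).trans (Finset.sum_le_sum fun j _ => le_trans ?_ (hdj j))
    rw [norm_mul, norm_pow]
    exact mul_le_of_le_one_right (norm_nonneg _) (pow_le_one₀ (norm_nonneg _) hz)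
  · rw [norm_pow]
    exact pow_le_one₀ (norm_nonneg _) hz

end LowerBound

/-! ### Growth of cyclotomic values at fifth roots of unity -/

section FifthRoots

open Polynomial ComplexConjugate

theorem norm_eval_cyclotomic_conj (n : ℕ) (z : ℂ) :
    ‖(cyclotomic n ℂ).eval (conj z)‖ = ‖(cyclotomic n ℂ).eval z‖ := by
  have h : (cyclotomic n ℂ).eval (conj z) = conj ((cyclotomic n ℂ).eval z) := by
    rw [← eval₂_at_apply, ← eval_map, map_cyclotomic]
  rw [h, Complex.norm_conj]

/-- On the unit circle, `|1 + z| = 1` forces `z ^ 2 + z + 1 = 0`, so `z` would have order 3. This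
makes the growth constant nonzero. -/
theorem IsPrimitiveRoot.norm_one_add_ne_one {z : ℂ} (hz : IsPrimitiveRoot z 5) :
    ‖1 + z‖ ≠ 1 := by
  intro h
  have h1 : ‖z‖ = 1 := hz.norm'_eq_one (by norm_num)
  have h2 : z * conj z = 1 := by rw [Complex.mul_conj']; simp [h1]
  have h3 : (1 + z) * (1 + conj z) = 1 := by
    rw [show (1 + conj z) = conj (1 + z) by simp, Complex.mul_conj']; simp [h]
  have h4 : z ^ 2 + z + 1 = 0 := by linear_combination z * h3 - (1 + z) * h2
  have h5 := hz.pow_eq_one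
  have h6 : z = 1 := by linear_combination -z * h5 + (z ^ 4 - z ^ 3 + z - 1) * h4
  exact hz.ne_one (by norm_num) h6

theorem IsPrimitiveRoot.norm_one_add_pos {z : ℂ} (hz : IsPrimitiveRoot z 5) : 0 < ‖1 + z‖ := by
  rw [norm_pos_iff]
  intro h
  have h5 := hz.pow_eq_one
  have hz1 : z = -1 := by linear_combination h
  rw [hz1] at h5
  norm_num at h5

/-- Values of `Φ_n` at primitive fifth roots of unity, for `n` a product of distinct primes
congruent to `±2` modulo `5`. -/
theorem norm_eval_cyclotomic_primitive_fifth_root {z : ℂ} (hz : IsPrimitiveRoot z 5) (p : ℕ → ℕ)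
    (hp : ∀ i, (p i).Prime ∧ (p i % 5 = 2 ∨ p i % 5 = 3)) (hinj : Function.Injective p) (k : ℕ) :
    0 < ‖(cyclotomic (∏ i ∈ Finset.range k, p i) ℂ).eval z‖ ∧
    0 < ‖(cyclotomic (∏ i ∈ Finset.range k, p i) ℂ).eval (z ^ 2)‖ ∧
    Real.log ‖(cyclotomic (∏ i ∈ Finset.range k, p i) ℂ).eval (z ^ 2)‖ -
      Real.log ‖(cyclotomic (∏ i ∈ Finset.range k, p i) ℂ).eval z‖ =
        (-2) ^ k * Real.log ‖1 + z‖ ∧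
    ‖(cyclotomic (∏ i ∈ Finset.range (k + 1), p i) ℂ).eval z‖ =
      Real.exp ((-2) ^ k * Real.log ‖1 + z‖) ∧
    ‖(cyclotomic (∏ i ∈ Finset.range (k + 1), p i) ℂ).eval (z ^ 2)‖ =
      Real.exp (-((-2) ^ k * Real.log ‖1 + z‖)) := by
  have h1 : ‖z‖ = 1 := hz.norm'_eq_one (by norm_num)
  have h2 : z * conj z = 1 := by rw [Complex.mul_conj']; simp [h1]
  have h5 := hz.pow_eq_one
  have hz0 : z ≠ 0 := by rintro rfl; simp at h1
  have hc : conj z = z ^ 4 := by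
    apply mul_left_cancel₀ hz0
    rw [h2]; linear_combination -h5
  have hpow : ∀ m r : ℕ, m % 5 = r → z ^ m = z ^ r := by
    intro m r h
    rw [← Nat.div_add_mod m 5, h, pow_add, pow_mul, h5, one_pow, one_mul]
  have hstep : ∀ k, ∀ w : ℂ,
      (cyclotomic (∏ i ∈ Finset.range k, p i) ℂ).eval (w ^ p k) =
        (cyclotomic (∏ i ∈ Finset.range (k + 1), p i) ℂ).eval w *
          (cyclotomic (∏ i ∈ Finset.range k, p i) ℂ).eval w := by
    intro k w
    have hdiv : ¬ p k ∣ ∏ i ∈ Finset.range k, p i := by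
      rw [(hp k).1.prime.dvd_finsetProd_iff]
      rintro ⟨i, hi, hd⟩
      have := hinj ((Nat.prime_dvd_prime_iff_eq (hp k).1 (hp i).1).1 hd)
      simp at hi
      omega
    have h := congrArg (eval w) (cyclotomic_expand_eq_cyclotomic_mul (hp k).1 hdiv ℂ)
    rw [expand_eval, eval_mul, ← Finset.prod_range_succ] at h
    exact h
  -- Raising to the power `p k` swaps the conjugate pairs `{z, z ^ 4}` and `{z ^ 2, z ^ 3}`, and
  -- norms do not distinguish conjugates.
  have hz_step : ∀ n k, ‖(cyclotomic n ℂ).eval (z ^ p k)‖ = ‖(cyclotomic n ℂ).eval (z ^ 2)‖ := by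
    intro n k
    rcases (hp k).2 with h | h
    · rw [hpow _ _ h]
    · rw [hpow _ _ h, ← norm_eval_cyclotomic_conj, map_pow, hc, ← pow_mul, hpow (4 * 3) 2 rfl]
  have hz2_step : ∀ n k, ‖(cyclotomic n ℂ).eval ((z ^ 2) ^ p k)‖ = ‖(cyclotomic n ℂ).eval z‖ := by
    intro n k
    rw [← pow_mul]
    rcases (hp k).2 with h | h
    · rw [hpow (2 * p k) 4 (by omega), ← hc, norm_eval_cyclotomic_conj]
    · rw [hpow (2 * p k) 1 (by omega), pow_one]
  have hone : 0 < ‖1 + z‖ := hz.norm_one_add_pos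
  have hnext : ∀ k, 0 < ‖(cyclotomic (∏ i ∈ Finset.range k, p i) ℂ).eval z‖ →
      0 < ‖(cyclotomic (∏ i ∈ Finset.range k, p i) ℂ).eval (z ^ 2)‖ →
      Real.log ‖(cyclotomic (∏ i ∈ Finset.range k, p i) ℂ).eval (z ^ 2)‖ -
        Real.log ‖(cyclotomic (∏ i ∈ Finset.range k, p i) ℂ).eval z‖ =
          (-2) ^ k * Real.log ‖1 + z‖ →
      ‖(cyclotomic (∏ i ∈ Finset.range (k + 1), p i) ℂ).eval z‖ =
        Real.exp ((-2) ^ k * Real.log ‖1 + z‖) ∧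
      ‖(cyclotomic (∏ i ∈ Finset.range (k + 1), p i) ℂ).eval (z ^ 2)‖ =
        Real.exp (-((-2) ^ k * Real.log ‖1 + z‖)) := by
    intro k ha hb hab
    have e1 := congrArg norm (hstep k z)
    have e2 := congrArg norm (hstep k (z ^ 2))
    rw [norm_mul, hz_step] at e1
    rw [norm_mul, hz2_step] at e2
    rw [← hab, neg_sub, Real.exp_sub, Real.exp_sub, Real.exp_log ha, Real.exp_log hb]
    exact ⟨by rw [e1, mul_div_assoc, div_self ha.ne', mul_one],
      by rw [e2, mul_div_assoc, div_self hb.ne', mul_one]⟩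
  have main : ∀ k, 0 < ‖(cyclotomic (∏ i ∈ Finset.range k, p i) ℂ).eval z‖ ∧
      0 < ‖(cyclotomic (∏ i ∈ Finset.range k, p i) ℂ).eval (z ^ 2)‖ ∧
      Real.log ‖(cyclotomic (∏ i ∈ Finset.range k, p i) ℂ).eval (z ^ 2)‖ -
        Real.log ‖(cyclotomic (∏ i ∈ Finset.range k, p i) ℂ).eval z‖ =
          (-2) ^ k * Real.log ‖1 + z‖ := by
    intro k
    induction k with
    | zero =>
      have hz1 : 0 < ‖z - 1‖ := norm_pos_iff.2 (sub_ne_zero.2 (hz.ne_one (by norm_num)))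
      -- For `Φ_1 = X - 1` the ratio of the two values is `|z + 1|`.
      have hf : ‖z ^ 2 - 1‖ = ‖1 + z‖ * ‖z - 1‖ := by
        rw [← norm_mul]; congr 1; ring
      simp only [Finset.range_zero, Finset.prod_empty, cyclotomic_one, eval_sub, eval_X, eval_one,
        pow_zero, one_mul]
      rw [hf, Real.log_mul hone.ne' hz1.ne']
      exact ⟨hz1, mul_pos hone hz1, by ring⟩
    | succ k ih =>
      obtain ⟨e1, e2⟩ := hnext k ih.1 ih.2.1 ih.2.2
      rw [e1, e2, Real.log_exp, Real.log_exp]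
      exact ⟨Real.exp_pos _, Real.exp_pos _, by rw [pow_succ]; ring⟩
  obtain ⟨h₁, h₂, h₃⟩ := main k
  exact ⟨h₁, h₂, h₃, hnext k h₁ h₂ h₃⟩

/-- Cyclotomic polynomials of products of primes that are quadratic non-residues modulo `5` are
large at some fifth root of unity. -/
theorem exists_pos_forall_exists_exp_le_norm_eval_cyclotomic :
    ∃ c : ℝ, 0 < c ∧ ∀ p : ℕ → ℕ, (∀ i, (p i).Prime ∧ (p i % 5 = 2 ∨ p i % 5 = 3)) →
      Function.Injective p → ∀ k : ℕ, ∃ z : ℂ, ‖z‖ ≤ 1 ∧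
        Real.exp (2 ^ k * c) ≤
          ‖(cyclotomic (∏ i ∈ Finset.range (k + 1), p i) ℂ).eval z‖ := by
  obtain ⟨z, hz⟩ : ∃ z : ℂ, IsPrimitiveRoot z 5 :=
    ⟨_, Complex.isPrimitiveRoot_exp 5 (by norm_num)⟩
  refine ⟨|Real.log ‖1 + z‖|, ?_, fun p hp hinj k => ?_⟩
  · rw [abs_pos]
    exact Real.log_ne_zero_of_pos_of_ne_one hz.norm_one_add_pos hz.norm_one_add_ne_one
  · obtain ⟨-, -, -, h1, h2⟩ := norm_eval_cyclotomic_primitive_fifth_root hz p hp hinj k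
    have hz1 : ‖z‖ = 1 := hz.norm'_eq_one (by norm_num)
    have habs : (2 : ℝ) ^ k * |Real.log ‖1 + z‖| = |(-2) ^ k * Real.log ‖1 + z‖| := by
      simp [abs_mul, abs_pow]
    rw [habs]
    rcases abs_choice ((-2 : ℝ) ^ k * Real.log ‖1 + z‖) with h | h
    · exact ⟨z, hz1.le, by rw [h, h1]⟩
    · exact ⟨z ^ 2, by simp [hz1], by rw [h, h2]⟩

end FifthRoots

/-! ### Majorization and comparison with the zeta function -/

section Comparison

open Filter Topology Finset

theorem convexOn_mul_exp_neg {s : ℝ} (hs : 1 ≤ s) :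
    ConvexOn ℝ (Set.Ici 2) fun t : ℝ => t * Real.exp (-s * t) := by
  have hd : ∀ t : ℝ, HasDerivAt (fun t : ℝ => t * Real.exp (-s * t))
      ((1 - s * t) * Real.exp (-s * t)) t := by
    intro t
    exact ((hasDerivAt_id t).mul (((hasDerivAt_id t).const_mul (-s)).exp)).congr_deriv
      (by simp only [id]; ring)
  have hd2 : ∀ t : ℝ, HasDerivAt (fun t : ℝ => (1 - s * t) * Real.exp (-s * t))
      (s * (s * t - 2) * Real.exp (-s * t)) t := by
    intro t
    exact ((((hasDerivAt_id t).const_mul s).const_sub 1).mul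
      (((hasDerivAt_id t).const_mul (-s)).exp)).congr_deriv (by simp only [id]; ring)
  refine convexOn_of_hasDerivWithinAt2_nonneg (convex_Ici 2) (by fun_prop)
    (fun t _ => (hd t).hasDerivWithinAt) (fun t _ => (hd2 t).hasDerivWithinAt) fun t ht => ?_
  rw [interior_Ici, Set.mem_Ioi] at ht
  have : 0 ≤ s * t - 2 := by nlinarith
  positivity

/-- Tangent line inequality at `a`; `s ≥ 1` and arguments at least 2 stay in the convex range `s * t
≥ 2`. -/
theorem mul_exp_neg_sub_le {s a b : ℝ} (hs : 1 ≤ s) (ha : 2 ≤ a) (hb : 2 ≤ b) :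
    a * Real.exp (-s * a) - b * Real.exp (-s * b) ≤
      -((s * a - 1) * Real.exp (-s * a)) * (a - b) := by
  have hd : HasDerivAt (fun t : ℝ => t * Real.exp (-s * t))
      ((1 - s * a) * Real.exp (-s * a)) a := by
    exact ((hasDerivAt_id a).mul (((hasDerivAt_id a).const_mul (-s)).exp)).congr_deriv
      (by simp only [id]; ring)
  have hc := convexOn_mul_exp_neg hs
  rcases lt_trichotomy a b with h | h | h
  · have := hc.le_slope_of_hasDerivAt (Set.mem_Ici.2 ha) (Set.mem_Ici.2 hb) h hd
    rw [slope_def_field, le_div_iff₀ (by linarith)] at this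
    linarith
  · simp [h]
  · have := hc.slope_le_of_hasDerivAt (Set.mem_Ici.2 hb) (Set.mem_Ici.2 ha) h hd
    rw [slope_def_field, div_le_iff₀ (by linarith)] at this
    linarith

/-- Minus the derivative of a convex function is antitone: add the tangent inequalities at `a` and
at `b`. -/
theorem mul_sub_one_exp_neg_le {s a b : ℝ} (hs : 1 ≤ s) (ha : 2 ≤ a) (hab : a ≤ b) :
    (s * b - 1) * Real.exp (-s * b) ≤ (s * a - 1) * Real.exp (-s * a) := by
  have h1 := mul_exp_neg_sub_le hs ha (ha.trans hab)
  have h2 := mul_exp_neg_sub_le hs (ha.trans hab) ha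
  rcases hab.eq_or_lt with h | h
  · simp [h]
  · have h3 : 0 ≤ ((s * a - 1) * Real.exp (-s * a) - (s * b - 1) * Real.exp (-s * b)) * (b - a) := by
      linarith
    linarith [nonneg_of_mul_nonneg_left h3 (by linarith)]

/-- Abel summation inequality: if `w` is nonnegative and antitone and the partial sums of `x` are
at least `-K`, then the partial sums of `w * x` are at least `-K * w 0`. -/
theorem neg_mul_le_sum_mul_of_antitone {w x : ℕ → ℝ} {K : ℝ} (hw : Antitone w)
    (hw0 : ∀ i, 0 ≤ w i) (hx : ∀ N, -K ≤ ∑ i ∈ range N, x i) (N : ℕ) :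
    -(K * w 0) ≤ ∑ i ∈ range N, w i * x i := by
  have key : ∀ N, w N * (∑ i ∈ range N, x i + K) ≤ ∑ i ∈ range N, w i * x i + K * w 0 := by
    intro N
    induction N with
    | zero => simp [mul_comm]
    | succ N ih =>
      have h1 : w (N + 1) * (∑ i ∈ range (N + 1), x i + K) ≤
          w N * (∑ i ∈ range (N + 1), x i + K) :=
        mul_le_mul_of_nonneg_right (hw N.le_succ) (by linarith [hx (N + 1)])
      refine h1.trans ?_
      rw [sum_range_succ, sum_range_succ]
      linarith
  have h := key N
  have : 0 ≤ w N * (∑ i ∈ range N, x i + K) := mul_nonneg (hw0 N) (by linarith [hx N])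
  linarith

/-- Weak majorization for the convex function `t ↦ t * exp (-s * t)`. -/
theorem sum_mul_exp_neg_le_of_partial_sums {a b : ℕ → ℝ} {K : ℝ} (ha : Monotone a)
    (ha2 : ∀ i, 2 ≤ a i) (hb2 : ∀ i, 2 ≤ b i)
    (hab : ∀ N, -K ≤ ∑ i ∈ range N, (a i - b i)) {s : ℝ} (hs : 1 ≤ s) (hs2 : s ≤ 2) (hK : 0 ≤ K)
    (N : ℕ) :
    ∑ i ∈ range N, a i * Real.exp (-s * a i) ≤
      ∑ i ∈ range N, b i * Real.exp (-s * b i) + K * (2 * a 0) := by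
  have h := neg_mul_le_sum_mul_of_antitone
    (w := fun i => (s * a i - 1) * Real.exp (-s * a i))
    (fun i j hij => mul_sub_one_exp_neg_le hs (ha2 i) (ha hij))
    (fun i => mul_nonneg (by nlinarith [ha2 i]) (Real.exp_pos _).le) hab N
  have h1 : ∑ i ∈ range N, (a i * Real.exp (-s * a i) - b i * Real.exp (-s * b i)) ≤
      ∑ i ∈ range N, -((s * a i - 1) * Real.exp (-s * a i) * (a i - b i)) :=
    sum_le_sum fun i _ => (mul_exp_neg_sub_le hs (ha2 i) (hb2 i)).trans_eq (by ring)
  rw [sum_sub_distrib, sum_neg_distrib] at h1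
  -- `s ≤ 2` makes the error term independent of `s`.
  have h2 : (s * a 0 - 1) * Real.exp (-s * a 0) ≤ 2 * a 0 := by
    have := ha2 0
    have h3 : Real.exp (-s * a 0) ≤ 1 := Real.exp_le_one_iff.2 (by nlinarith)
    calc _ ≤ (s * a 0 - 1) * 1 := mul_le_mul_of_nonneg_left h3 (by nlinarith)
      _ ≤ _ := by nlinarith
  have := mul_le_mul_of_nonneg_left h2 hK
  linarith

/-- A discrete derivative bound, used to telescope the comparison sequence. -/
theorem log_add_loglog_le_sub {x : ℝ} (hx : 1 < x) (c : ℝ) :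
    Real.log x + Real.log (Real.log x) + (1 - c) ≤
      (x + 1) * (Real.log (x + 1) + Real.log (Real.log (x + 1)) - c) -
        x * (Real.log x + Real.log (Real.log x) - c) := by
  have hlog : 0 < Real.log x := Real.log_pos hx
  have h1 : Real.log (Real.log x) ≤ Real.log (Real.log (x + 1)) :=
    Real.log_le_log hlog (Real.log_le_log (by linarith) (by linarith))
  have h2 : 1 / (x + 1) ≤ Real.log (x + 1) - Real.log x := by
    rw [← Real.log_div (by linarith) (by linarith)]
    have := Real.one_sub_inv_le_log_of_pos (x := (x + 1) / x) (by positivity)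
    refine le_trans (le_of_eq ?_) this
    field_simp; ring
  have h3 : 1 ≤ (x + 1) * (Real.log (x + 1) - Real.log x) := by
    rw [div_le_iff₀ (by linarith)] at h2
    linarith
  have h4 := mul_le_mul_of_nonneg_left h1 (show 0 ≤ x + 1 by linarith)
  nlinarith

theorem exp_neg_le_two_fifths : Real.exp (-(1 - 8 / 100)) ≤ 2 / 5 := by
  have h1 := Real.exp_one_gt_d9
  have h2 := Real.add_one_le_exp (-(8 / 100) : ℝ)
  have h3 : Real.exp (1 - 8 / 100) = Real.exp 1 * Real.exp (-(8 / 100)) := by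
    rw [← Real.exp_add]; norm_num
  rw [Real.exp_neg, h3]
  refine inv_le_of_inv_le₀ (by norm_num) ?_
  nlinarith

/-- The slack `8/100` absorbs the `C * log` term, which is `o(x)`. -/
theorem eventually_mul_log_add_loglog_le (C : ℝ) :
    ∀ᶠ x : ℝ in atTop, x * (Real.log x + Real.log (Real.log x) - 8 / 100) ≤
      (x - C) * Real.log (x * (Real.log x + Real.log (Real.log x) - 8 / 100)) := by
  have hll : Tendsto (fun x => Real.log (Real.log x)) atTop atTop :=
    Real.tendsto_log_atTop.comp Real.tendsto_log_atTop
  have hlo : ∀ᶠ x : ℝ in atTop, Real.log x ≤ 2 / 100 / (|C| + 1) * x := by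
    have := Real.isLittleO_log_id_atTop.bound (c := 2 / 100 / (|C| + 1)) (by positivity)
    filter_upwards [this, eventually_ge_atTop 1] with x hx h1
    simpa [abs_of_nonneg (Real.log_nonneg h1), abs_of_nonneg (zero_le_one.trans h1)] using hx
  filter_upwards [hlo, hll.eventually_ge_atTop 1, Real.tendsto_log_atTop.eventually_ge_atTop 1,
    eventually_gt_atTop 0, eventually_ge_atTop C] with x h1 h2 h3 h4 h5
  set l := Real.log x
  set m := Real.log l
  have hm : m ≤ l := Real.log_le_self (by linarith)
  have hle : l + m ≤ Real.log (x * (l + m - 8 / 100)) := by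
    rw [Real.log_mul h4.ne' (by linarith)]
    have := Real.log_le_log (show 0 < l by linarith) (show l ≤ l + m - 8 / 100 by linarith)
    change m ≤ _ at this
    linarith
  have h6 := mul_le_mul_of_nonneg_left hle (sub_nonneg.2 h5)
  have h7 : C * (l + m) ≤ 4 / 100 * x := by
    have : (|C| + 1) * l ≤ 2 / 100 * x := by
      have := mul_le_mul_of_nonneg_left h1 (show 0 ≤ |C| + 1 by positivity)
      refine this.trans (le_of_eq ?_)
      field_simp
    have hC := le_abs_self C
    have : C * (l + m) ≤ |C| * (2 * l) :=
      mul_le_mul hC (by linarith) (by linarith) (abs_nonneg _)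
    nlinarith
  nlinarith

theorem div_log_le_div_log {x y : ℝ} (hx : Real.exp 1 ≤ x) (hxy : x ≤ y) :
    x / Real.log x ≤ y / Real.log y := by
  have hx0 : 0 < x := (Real.exp_pos 1).trans_le hx
  have hl : 1 ≤ Real.log x := by rwa [Real.le_log_iff_exp_le hx0]
  have hl2 := Real.log_le_log hx0 hxy
  have h := Real.log_div_self_antitoneOn hx (hx.trans hxy) hxy
  simp only at h
  rw [div_le_div_iff₀ (hx0.trans_le hxy) hx0] at h
  rw [div_le_div_iff₀ (by linarith) (by linarith)]
  linarith

/-- If the sums `θ_j` of the first `j` terms of `a` eventually satisfy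
`(j - C) log θ_j < θ_j`, then `∑ a_i exp (-s a_i)` is at most `0.48 ζ(s)`
up to a constant, for `1 < s ≤ 2`. -/
theorem exists_sum_mul_exp_neg_le_of_eventually {a : ℕ → ℝ} (ha : Monotone a)
    (hainf : Tendsto a atTop atTop) (ha0 : ∀ i, 0 ≤ a i) (C : ℝ)
    (hC : ∀ᶠ j : ℕ in atTop, ((j : ℝ) - C) * Real.log (∑ i ∈ range j, a i) <
      ∑ i ∈ range j, a i) :
    ∃ K : ℝ, ∀ s : ℝ, 1 < s → s ≤ 2 → ∀ N,
      ∑ i ∈ range N, a i * Real.exp (-s * a i) ≤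
        48 / 100 * (∑' i : ℕ, 1 / (i : ℝ) ^ s) + K := by
  -- `T j` is a lower bound for `θ_j`, and `b` is dominated by its increments.
  set T : ℝ → ℝ := fun x => x * (Real.log x + Real.log (Real.log x) - 8 / 100) with hT
  set b : ℕ → ℝ := fun i => Real.log i + Real.log (Real.log i) + (1 - 8 / 100) with hb
  have hll : Tendsto (fun x => Real.log (Real.log x)) atTop atTop :=
    Real.tendsto_log_atTop.comp Real.tendsto_log_atTop
  have hloglog : ∀ᶠ x : ℝ in atTop, Real.log (Real.log x) ≤ 1 / 10 * Real.log x := by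
    have := (Real.isLittleO_log_id_atTop.comp_tendsto Real.tendsto_log_atTop).bound
      (c := 1 / 10) (by norm_num)
    filter_upwards [this, hll.eventually_ge_atTop 0,
      Real.tendsto_log_atTop.eventually_ge_atTop 0] with x hx h1 h2
    simpa [abs_of_nonneg h1, abs_of_nonneg h2] using hx
  have hsum : Tendsto (fun j : ℕ => ∑ i ∈ range j, a i) atTop atTop := by
    refine (tendsto_add_atTop_iff_nat 1).1 (tendsto_atTop_mono (fun j => ?_) hainf)
    rw [sum_range_succ]
    exact le_add_of_nonneg_left (sum_nonneg fun i _ => ha0 i)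
  have hev : ∀ᶠ j : ℕ in atTop, T j ≤ ∑ i ∈ range j, a i ∧ 2 ≤ a j ∧ 20 ≤ Real.log j ∧
      1 ≤ Real.log (Real.log j) ∧ Real.log (Real.log j) ≤ 1 / 10 * Real.log j := by
    have hcast := tendsto_natCast_atTop_atTop (R := ℝ)
    filter_upwards [hC, hcast.eventually (eventually_mul_log_add_loglog_le C),
      hainf.eventually_ge_atTop 2, hcast.eventually (Real.tendsto_log_atTop.eventually_ge_atTop 20),
      hcast.eventually (hll.eventually_ge_atTop 1), hcast.eventually hloglog,
      hsum.eventually_ge_atTop (Real.exp 1)] with j h1 h2 h3 h4 h5 h6 h7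
    refine ⟨?_, h3, h4, h5, h6⟩
    -- As `x / log x` increases, `θ_j < T j` would give `θ_j / log θ_j ≤ j - C`.
    by_contra! hlt
    have h8 := div_log_le_div_log h7 hlt.le
    have h9 : 1 ≤ Real.log (∑ i ∈ range j, a i) := by
      rwa [Real.le_log_iff_exp_le ((Real.exp_pos 1).trans_le h7)]
    have h10 : 1 ≤ Real.log (T j) :=
      h9.trans (Real.log_le_log ((Real.exp_pos 1).trans_le h7) hlt.le)
    change T j ≤ ((j : ℝ) - C) * Real.log (T j) at h2
    rw [← lt_div_iff₀ (by linarith)] at h1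
    rw [← div_le_iff₀ (by linarith)] at h2
    linarith
  obtain ⟨J, hJ⟩ := eventually_atTop.1 hev
  have hb2 : ∀ j, J ≤ j → 2 ≤ b j := fun j hj => by
    obtain ⟨-, -, h1, h2, -⟩ := hJ j hj
    simp only [hb]; linarith
  have hbT : ∀ N, ∑ i ∈ range N, b (J + i) ≤ T ((J + N : ℕ) : ℝ) - T J := by
    intro N
    induction N with
    | zero => simp
    | succ N ih =>
      have hx : (1 : ℝ) < ((J + N : ℕ) : ℝ) := by
        obtain ⟨-, -, h1, -⟩ := hJ (J + N) (by omega)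
        by_contra! h
        have := Real.log_nonpos (Nat.cast_nonneg _) h
        linarith
      have h := log_add_loglog_le_sub hx (8 / 100)
      rw [sum_range_succ, show J + (N + 1) = (J + N) + 1 by ring, Nat.cast_succ (J + N)]
      simp only [hb, hT] at ih ⊢
      linarith
  set K := ∑ i ∈ range J, a i with hK
  have hK0 : 0 ≤ K := sum_nonneg fun i _ => ha0 i
  have hTJ : 0 ≤ T J := by
    obtain ⟨-, -, h1, h2, -⟩ := hJ J le_rfl
    exact mul_nonneg (Nat.cast_nonneg _) (by linarith)
  have hab : ∀ N, -K ≤ ∑ i ∈ range N, (a (J + i) - b (J + i)) := by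
    intro N
    have h1 := (hJ (J + N) (by omega)).1
    rw [sum_range_add] at h1
    rw [sum_sub_distrib]
    linarith [hbT N]
  refine ⟨K * (2 * a J) + K, fun s hs hs2 N => ?_⟩
  have hsumm : Summable fun i : ℕ => 1 / (i : ℝ) ^ s := Real.summable_one_div_nat_rpow.2 hs
  have hmaj := sum_mul_exp_neg_le_of_partial_sums (a := fun i => a (J + i))
    (b := fun i => b (J + i)) (fun i j hij => ha (by omega)) (fun i => (hJ _ (by omega)).2.1)
    (fun i => hb2 _ (by omega)) hab hs.le hs2 hK0 N
  -- `48/100 = 12/10 * 2/5`: the first factor bounds `b j / log j`, the second bounds `exp (-0.92)`.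
  -- The product must be below `1/2`.
  have hbb : ∀ j, J ≤ j → b j * Real.exp (-s * b j) ≤ 48 / 100 * (1 / (j : ℝ) ^ s) := by
    intro j hj
    obtain ⟨-, -, h1, h2, h3⟩ := hJ j hj
    have hj0 : (0 : ℝ) < j := by
      by_contra! h
      have := Real.log_nonpos (Nat.cast_nonneg j) (h.trans zero_le_one)
      linarith
    have e1 : Real.exp (-s * b j) ≤ Real.exp (-s * Real.log j) * (Real.exp (-(1 - 8 / 100)) *
        Real.exp (-Real.log (Real.log j))) := by
      rw [← Real.exp_add, ← Real.exp_add, Real.exp_le_exp]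
      simp only [hb]
      nlinarith
    rw [Real.exp_neg (Real.log (Real.log j)), Real.exp_log (by linarith),
      show -s * Real.log j = -(Real.log j * s) by ring, Real.exp_neg,
      ← Real.rpow_def_of_pos hj0] at e1
    have e2 : b j ≤ 12 / 10 * Real.log j := by simp only [hb]; linarith
    have hp : 0 < (j : ℝ) ^ s := Real.rpow_pos_of_pos hj0 s
    calc b j * Real.exp (-s * b j)
        ≤ (12 / 10 * Real.log j) * (((j : ℝ) ^ s)⁻¹ * (2 / 5 * (Real.log j)⁻¹)) := by
          refine mul_le_mul e2 (e1.trans ?_) (Real.exp_pos _).le (by linarith)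
          have := exp_neg_le_two_fifths
          gcongr
      _ = _ := by
          field_simp
          norm_num
  have h1 : ∑ i ∈ range N, b (J + i) * Real.exp (-s * b (J + i)) ≤
      48 / 100 * ∑' i : ℕ, 1 / (i : ℝ) ^ s := by
    refine (sum_le_sum fun i _ => hbb (J + i) (by omega)).trans ?_
    rw [← mul_sum]
    refine mul_le_mul_of_nonneg_left ?_ (by norm_num)
    have : ∑ i ∈ range N, 1 / ((J + i : ℕ) : ℝ) ^ s ≤
        ∑ i ∈ range (J + N), 1 / (i : ℝ) ^ s := by
      rw [sum_range_add]
      exact le_add_of_nonneg_left (sum_nonneg fun i _ => by positivity)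
    exact this.trans (hsumm.sum_le_tsum _ fun i _ => by positivity)
  have h2 : ∑ i ∈ range N, a i * Real.exp (-s * a i) ≤
      ∑ i ∈ range (J + N), a i * Real.exp (-s * a i) :=
    sum_le_sum_of_subset_of_nonneg (range_subset_range.2 (by omega))
      fun i _ _ => mul_nonneg (ha0 i) (Real.exp_pos _).le
  have h3 : ∑ i ∈ range J, a i * Real.exp (-s * a i) ≤ K :=
    sum_le_sum fun i _ => mul_le_of_le_one_right (ha0 i)
      (Real.exp_le_one_iff.2 (by nlinarith [ha0 i]))
  rw [sum_range_add] at h2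
  simp only [add_zero] at hmaj
  linarith

end Comparison

/-! ### Density of the primes congruent to ±2 modulo 5 -/

section Primes

open Filter Topology Finset ArithmeticFunction ArithmeticFunction.vonMangoldt

theorem infinite_prime_and_mod_five :
    {p : ℕ | p.Prime ∧ (p % 5 = 2 ∨ p % 5 = 3)}.Infinite := by
  refine (Nat.infinite_setOfPred_prime_and_modEq (q := 5) (a := 2) (by norm_num)
    (by norm_num)).mono fun p hp => ⟨hp.1, Or.inl hp.2⟩

theorem summable_vonMangoldt_div_rpow {s : ℝ} (hs : 1 < s) :
    Summable fun n : ℕ => vonMangoldt n / (n : ℝ) ^ s := by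
  have h := (LSeriesSummable_vonMangoldt (s := (s : ℂ)) (by simpa using hs)).norm
  refine h.congr fun n => ?_
  rcases Nat.eq_zero_or_pos n with rfl | hn
  · simp
  · rw [LSeries.norm_term_eq]
    simp [hn.ne', abs_of_nonneg vonMangoldt_nonneg]

/-- Dirichlet's lower bound gives `1/4 / (s - 1)` for each of the two residue classes, up to
constants. Proper prime powers contribute at most their convergent sum at `s = 1`, so `M` does not
depend on `s`. -/
theorem exists_le_of_forall_sum_log_mul_exp_le {p : ℕ → ℕ} (hinj : Function.Injective p)
    (hp : Set.range p = {p : ℕ | p.Prime ∧ (p % 5 = 2 ∨ p % 5 = 3)}) :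
    ∃ M : ℝ, ∀ s : ℝ, 1 < s → s ≤ 2 → ∀ B : ℝ,
      (∀ N, ∑ i ∈ range N, Real.log (p i) * Real.exp (-s * Real.log (p i)) ≤ B) →
        1 / 2 / (s - 1) ≤ B + M := by
  have h2 : IsUnit (2 : ZMod 5) := by decide
  have h3 : IsUnit (3 : ZMod 5) := by decide
  obtain ⟨C₂, hC₂⟩ := LSeries_residueClass_lower_bound h2
  obtain ⟨C₃, hC₃⟩ := LSeries_residueClass_lower_bound h3
  set R : ZMod 5 → ℕ → ℝ := fun a n => (if n.Prime then 0 else residueClass a n) / n with hR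
  have hRs : ∀ a, Summable (R a) := fun a => summable_residueClass_non_primes_div a
  refine ⟨C₂ + C₃ + (∑' n, R 2 n + ∑' n, R 3 n), fun s hs hs2 B hB => ?_⟩
  have hΛ := summable_vonMangoldt_div_rpow hs
  have hsum : ∀ a : ZMod 5, Summable fun n : ℕ => residueClass a n / (n : ℝ) ^ s := fun a =>
    hΛ.of_nonneg_of_le (fun n => div_nonneg (residueClass_nonneg a n) (by positivity))
      fun n => div_le_div_of_nonneg_right (residueClass_le a n) (by positivity)
  set G : ℕ → ℝ := (Set.range p).indicator fun n => Real.log n * Real.exp (-s * Real.log n)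
    with hG
  have hterm : ∀ i, 0 ≤ Real.log (p i) * Real.exp (-s * Real.log (p i)) := fun i =>
    mul_nonneg (Real.log_natCast_nonneg _) (Real.exp_pos _).le
  have hGp : ∀ i, G (p i) = Real.log (p i) * Real.exp (-s * Real.log (p i)) := fun i =>
    Set.indicator_of_mem (Set.mem_range_self i) _
  have hsummp : Summable fun i => G (p i) := by
    simp only [hGp]
    exact summable_of_sum_range_le hterm hB
  have hGs : Summable G :=
    (hinj.summable_iff fun n hn => Set.indicator_of_notMem hn _).1 hsummp
  have hGB : ∑' n, G n ≤ B := by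
    rw [← hinj.tsum_eq (f := G) (Set.support_indicator_subset)]
    simp only [hGp]
    exact Real.tsum_le_of_sum_range_le hterm hB
  have hle : ∀ n : ℕ, residueClass (2 : ZMod 5) n / (n : ℝ) ^ s +
      residueClass (3 : ZMod 5) n / (n : ℝ) ^ s ≤
      G n + (R 2 n + R 3 n) := by
    intro n
    rcases Nat.eq_zero_or_pos n with rfl | hn
    · have h0 : G 0 = 0 := by
        refine Set.indicator_of_notMem ?_ _
        rw [hp]
        exact fun h => Nat.not_prime_zero h.1
      simp [hR, h0]
    by_cases hnp : n.Prime
    · have hmod : ∀ r : ℕ, r < 5 → ((n : ZMod 5) = (r : ZMod 5) ↔ n % 5 = r) := by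
        intro r hr
        rw [ZMod.natCast_eq_natCast_iff, Nat.ModEq, Nat.mod_eq_of_lt hr]
      have hm2 := hmod 2 (by norm_num)
      have hm3 := hmod 3 (by norm_num)
      have hlog : Real.log n / (n : ℝ) ^ s = Real.log n * Real.exp (-s * Real.log n) := by
        rw [Real.rpow_def_of_pos (by exact_mod_cast hn), div_eq_mul_inv, ← Real.exp_neg]
        ring_nf
      have hG' : n % 5 = 2 ∨ n % 5 = 3 → G n = Real.log n / (n : ℝ) ^ s := by
        intro h
        rw [hlog]
        exact Set.indicator_of_mem (by rw [hp]; exact ⟨hnp, h⟩) _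
      have hR0 : ∀ a, R a n = 0 := fun a => by simp [hR, hnp]
      have hG0 : 0 ≤ G n := Set.indicator_nonneg (fun m _ =>
        mul_nonneg (Real.log_natCast_nonneg _) (Real.exp_pos _).le) n
      rw [hR0, hR0, add_zero, add_zero]
      have hr2 : residueClass (2 : ZMod 5) n = if n % 5 = 2 then Real.log n else 0 := by
        simp only [residueClass, Set.indicator_apply, Set.mem_ofPred_eq,
          vonMangoldt_apply_prime hnp]
        exact if_congr hm2 rfl rfl
      have hr3 : residueClass (3 : ZMod 5) n = if n % 5 = 3 then Real.log n else 0 := by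
        simp only [residueClass, Set.indicator_apply, Set.mem_ofPred_eq,
          vonMangoldt_apply_prime hnp]
        exact if_congr hm3 rfl rfl
      rw [hr2, hr3]
      by_cases c2 : n % 5 = 2
      · simp [c2, hG' (Or.inl c2)]
      · by_cases c3 : n % 5 = 3
        · simp [c3, hG' (Or.inr c3)]
        · simpa [c2, c3] using hG0
    · have hG0 : G n = 0 := by
        refine Set.indicator_of_notMem ?_ _
        rw [hp]
        exact fun h => hnp h.1
      have hn1 : (1 : ℝ) ≤ n := by exact_mod_cast hn
      have hpow : (n : ℝ) ≤ (n : ℝ) ^ s := by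
        simpa using Real.rpow_le_rpow_of_exponent_le hn1 hs.le
      simp only [hR, hG0, hnp, if_false, zero_add]
      exact add_le_add
        (div_le_div_of_nonneg_left (residueClass_nonneg 2 n) (by linarith) hpow)
        (div_le_div_of_nonneg_left (residueClass_nonneg 3 n) (by linarith) hpow)
  have hts := ((hsum 2).add (hsum 3)).tsum_le_tsum hle (hGs.add ((hRs 2).add (hRs 3)))
  rw [(hsum 2).tsum_add (hsum 3), hGs.tsum_add ((hRs 2).add (hRs 3)),
    (hRs 2).tsum_add (hRs 3)] at hts
  have e2 := hC₂ (x := s) ⟨hs, hs2⟩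
  have e3 := hC₃ (x := s) ⟨hs, hs2⟩
  have ht : (Nat.totient 5 : ℝ)⁻¹ / (s - 1) = 1 / 2 / (s - 1) / 2 := by
    rw [Nat.totient_prime (by norm_num)]
    norm_num; ring
  rw [ht] at e2 e3
  linarith

/-- For the primes that are quadratic non-residues modulo `5`, the product of the first `j` of
them has infinitely often at least `log n / log log n + C` prime factors. -/
theorem frequently_sum_log_le {p : ℕ → ℕ} (hmono : StrictMono p)
    (hp : Set.range p = {p : ℕ | p.Prime ∧ (p % 5 = 2 ∨ p % 5 = 3)}) (C : ℝ) :
    ∃ᶠ j : ℕ in atTop, ∑ i ∈ range j, Real.log (p i) ≤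
      ((j : ℝ) - C) * Real.log (∑ i ∈ range j, Real.log (p i)) := by
  intro hcon
  simp only [not_le] at hcon
  have hpos : ∀ i, 0 < p i := fun i => by
    have : p i ∈ Set.range p := ⟨i, rfl⟩
    rw [hp] at this
    exact this.1.pos
  obtain ⟨K, hK⟩ := exists_sum_mul_exp_neg_le_of_eventually
    (a := fun i => Real.log (p i))
    (fun i j hij => Real.log_le_log (by exact_mod_cast hpos i)
      (by exact_mod_cast hmono.monotone hij))
    (Real.tendsto_log_atTop.comp (tendsto_natCast_atTop_atTop.comp hmono.tendsto_atTop))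
    (fun i => Real.log_natCast_nonneg _) C hcon
  obtain ⟨M, hM⟩ := exists_le_of_forall_sum_log_mul_exp_le hmono.injective hp
  -- After multiplication by `s - 1`, the limit `s → 1⁺` yields `1/2 ≤ 48/100`.
  have hlim : Tendsto (fun s : ℝ => 48 / 100 * ((s - 1) * ∑' n : ℕ, 1 / (n : ℝ) ^ s) +
      (s - 1) * (K + M)) (𝓝[>] 1) (𝓝 (48 / 100 * 1 + (1 - 1) * (K + M))) := by
    refine (tendsto_sub_mul_tsum_nat_rpow.const_mul _).add ?_
    exact (Continuous.tendsto (by fun_prop) 1).mono_left nhdsWithin_le_nhds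
  have hge : ∀ᶠ s : ℝ in 𝓝[>] 1, 1 / 2 ≤ 48 / 100 * ((s - 1) * ∑' n : ℕ, 1 / (n : ℝ) ^ s) +
      (s - 1) * (K + M) := by
    filter_upwards [Ioc_mem_nhdsGT (show (1 : ℝ) < 2 by norm_num)] with s hs
    have h := hM s hs.1 hs.2 _ (hK s hs.1 hs.2)
    rw [div_le_iff₀ (by linarith [hs.1])] at h
    linarith
  have := ge_of_tendsto hlim hge
  norm_num at this

end Primes

/-! ### Choice of `n` and conclusion -/

section Main

open Filter Topology Finset

theorem add_one_lt_exp_of_two_mul_le {E y : ℝ} (hE : 1 ≤ E) (hy : 2 * E ≤ y) :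
    Real.exp E + 1 < Real.exp y := by
  have h1 := Real.add_one_le_exp E
  have h2 : Real.exp E * Real.exp E ≤ Real.exp y := by
    rw [← Real.exp_add, Real.exp_le_exp]; linarith
  nlinarith

theorem eventually_mul_rpow_le_exp_rpow_div_sqrt (r B : ℝ) :
    ∀ᶠ n : ℕ in atTop, B * (n : ℝ) ^ r ≤
      Real.exp ((n : ℝ) ^ (Real.log 2 / Real.log (Real.log (n : ℝ)))) / Real.sqrt (n : ℝ) := by
  have hll : Tendsto (fun x => Real.log (Real.log x)) atTop atTop :=
    Real.tendsto_log_atTop.comp Real.tendsto_log_atTop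
  have hsq : ∀ᶠ x : ℝ in atTop, Real.log x ^ 2 ≤ Real.log 2 / 2 * x := by
    have h2 := Real.log_pos one_lt_two
    have h := (isLittleO_log_rpow_rpow_atTop (s := 1) 2 one_pos).bound
      (c := Real.log 2 / 2) (by positivity)
    filter_upwards [h, eventually_ge_atTop 0] with x hx h0
    simpa [abs_of_nonneg h0] using hx
  have hreal : ∀ᶠ x : ℝ in atTop, B * x ^ r ≤
      Real.exp (x ^ (Real.log 2 / Real.log (Real.log x))) / Real.sqrt x := by
    filter_upwards [Real.tendsto_log_atTop.eventually hsq, hll.eventually_ge_atTop 1,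
      Real.tendsto_log_atTop.eventually_ge_atTop 1, eventually_gt_atTop 0,
      Real.tendsto_log_atTop.eventually_ge_atTop (r + 1 / 2 + |B|)] with x h1 h2 h3 h4 h5
    -- With `L = log x`, the right side is `exp (log 2 * L / log L)`, and `2 (log L) ^ 2 ≤ log 2 *
    -- L` by `hsq`. The square then beats every fixed multiple of `L`.
    have hE : Real.log x ^ 2 ≤ x ^ (Real.log 2 / Real.log (Real.log x)) := by
      rw [Real.rpow_def_of_pos h4, ← Real.exp_log (show 0 < Real.log x by linarith),
        ← Real.exp_nat_mul, Real.exp_log (show 0 < Real.log x by linarith), Real.exp_le_exp,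
        mul_div_assoc', le_div_iff₀ (by linarith)]
      push_cast
      nlinarith
    rw [le_div_iff₀ (Real.sqrt_pos.2 h4), Real.sqrt_eq_rpow, mul_assoc, ← Real.rpow_add h4]
    have hB : B ≤ Real.exp (Real.log x * |B|) := by
      have := Real.add_one_le_exp (Real.log x * |B|)
      nlinarith [le_abs_self B, abs_nonneg B]
    calc B * x ^ (r + 1 / 2)
        ≤ Real.exp (Real.log x * |B|) * x ^ (r + 1 / 2) :=
          mul_le_mul_of_nonneg_right hB (Real.rpow_nonneg h4.le _)
      _ ≤ _ := by
          rw [Real.rpow_def_of_pos h4, ← Real.exp_add, Real.exp_le_exp]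
          nlinarith
  exact tendsto_natCast_atTop_atTop.eventually hreal

theorem infinite_exp_rpow_div_sqrt_lt_condNumber
    (ζ : (n : ℕ) → Fin (Nat.totient n) → ℂ)
    (hζ : ∀ n : ℕ, 0 < n → EnumeratesPrimitiveRoots n (ζ n)) :
    {n : ℕ | 0 < n ∧
      condNumber (Matrix.vandermonde (ζ n)) >
        Real.exp ((n : ℝ) ^ (Real.log 2 / Real.log (Real.log (n : ℝ)))) /
          Real.sqrt (n : ℝ)}.Infinite := by
  obtain ⟨c, hc, hcyc⟩ := exists_pos_forall_exists_exp_le_norm_eval_cyclotomic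
  -- The `4` pays for `2 ^ k` against `2 ^ (k + 1)` and for the margin `2 * E` that absorbs the `+
  -- 1`.
  obtain ⟨C, hC⟩ := pow_unbounded_of_one_lt (4 / c) one_lt_two
  set p : ℕ → ℕ := Nat.nth fun p => p.Prime ∧ (p % 5 = 2 ∨ p % 5 = 3) with hp
  have hinf := infinite_prime_and_mod_five
  have hmono : StrictMono p := Nat.nth_strictMono hinf
  have hmem : ∀ i, (p i).Prime ∧ (p i % 5 = 2 ∨ p i % 5 = 3) := Nat.nth_mem_of_infinite hinf
  have hrange : Set.range p = {p : ℕ | p.Prime ∧ (p % 5 = 2 ∨ p % 5 = 3)} :=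
    Nat.range_nth_of_infinite hinf
  set n : ℕ → ℕ := fun j => ∏ i ∈ range j, p i with hn
  have hnpos : ∀ j, 0 < n j := fun j => prod_pos fun i _ => (hmem i).1.pos
  have hnmono : StrictMono n := strictMono_nat_of_lt_succ fun j => by
    simp only [hn, prod_range_succ]
    exact lt_mul_of_one_lt_right (hnpos j) (hmem j).1.one_lt
  have hlog : ∀ j, Real.log (n j) = ∑ i ∈ range j, Real.log (p i) := fun j => by
    rw [hn]
    push_cast
    exact Real.log_prod fun i _ => by exact_mod_cast (hmem i).1.ne_zero
  have hfreq := (frequently_sum_log_le hmono hrange C).and_eventually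
    ((hnmono.tendsto_atTop.eventually_ge_atTop 3).and (eventually_ge_atTop 1))
  rw [Nat.frequently_atTop_iff_infinite] at hfreq
  refine (hfreq.image hnmono.injective.injOn).mono ?_
  rintro _ ⟨j, ⟨hj, hj3, hj1⟩, rfl⟩
  refine ⟨hnpos j, ?_⟩
  have hn3 : (3 : ℝ) ≤ n j := by exact_mod_cast hj3
  rw [← hlog] at hj
  have hlog1 : 1 < Real.log (n j) := by
    rw [Real.lt_log_iff_exp_lt (by linarith)]
    linarith [Real.exp_one_lt_d9]
  have hll : 0 < Real.log (Real.log (n j)) := Real.log_pos hlog1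
  have h2 := Real.log_pos one_lt_two
  set E := (n j : ℝ) ^ (Real.log 2 / Real.log (Real.log (n j))) with hE
  have hE1 : 1 ≤ E := Real.one_le_rpow (by linarith) (by positivity)
  obtain ⟨k, rfl⟩ : ∃ k, j = k + 1 := ⟨j - 1, by omega⟩
  have hE2 : E * 2 ^ C ≤ 2 ^ (k + 1) := by
    have h : E ≤ 2 ^ (((k + 1 : ℕ) : ℝ) - C) := by
      rw [hE, Real.rpow_def_of_pos (by linarith), Real.rpow_def_of_pos two_pos, Real.exp_le_exp,
        mul_div_assoc', div_le_iff₀ hll]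
      nlinarith
    rwa [Real.rpow_sub two_pos, Real.rpow_natCast, Real.rpow_natCast,
      le_div_iff₀ (by positivity)] at h
  obtain ⟨z, hz, hzn⟩ := hcyc p hmem hmono.injective k
  have hcond := norm_eval_cyclotomic_le_condNumber_add_one (hnpos (k + 1))
    (hζ _ (hnpos (k + 1))) hz
  have hlarge : 2 * E ≤ 2 ^ k * c := by
    rw [div_lt_iff₀ hc] at hC
    have h1 : E * 4 ≤ E * (2 ^ C * c) := mul_le_mul_of_nonneg_left hC.le (by linarith)
    have h3 := mul_le_mul_of_nonneg_right hE2 hc.le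
    rw [pow_succ] at h3
    linarith
  have hexp := add_one_lt_exp_of_two_mul_le hE1 hlarge
  -- The bound already holds without the division by `√n`.
  have hdiv : Real.exp E / Real.sqrt (n (k + 1)) ≤ Real.exp E :=
    div_le_self (Real.exp_pos _).le (Real.one_le_sqrt.2 (by linarith))
  change Real.exp E / Real.sqrt (n (k + 1)) < _
  change _ ≤ ‖(Polynomial.cyclotomic (n (k + 1)) ℂ).eval z‖ at hzn
  linarith

end Main

theorem theorem1
    (ζ : (n : ℕ) → Fin (Nat.totient n) → ℂ)
    (hζ : ∀ n : ℕ, 0 < n → EnumeratesPrimitiveRoots n (ζ n)) :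
    {n : ℕ | 0 < n ∧
      condNumber (Matrix.vandermonde (ζ n)) >
        Real.exp ((n : ℝ) ^ (Real.log 2 / Real.log (Real.log (n : ℝ)))) /
          Real.sqrt (n : ℝ)}.Infinite ∧
    ∀ r : ℝ, 0 < r →
      ¬ Asymptotics.IsBigO Filter.atTop
          (fun n : ℕ => condNumber (Matrix.vandermonde (ζ n)))
          (fun n : ℕ => (n : ℝ) ^ r) := by
  have hinf := infinite_exp_rpow_div_sqrt_lt_condNumber ζ hζ
  refine ⟨hinf, fun r _ hO => ?_⟩
  obtain ⟨B, hB⟩ := hO.bound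
  obtain ⟨n, ⟨-, hn⟩, hle, hge⟩ := ((Nat.frequently_atTop_iff_infinite.2 hinf).and_eventually
    (hB.and (eventually_mul_rpow_le_exp_rpow_div_sqrt r B))).exists
  rw [Real.norm_of_nonneg (Real.rpow_nonneg (Nat.cast_nonneg n) r)] at hle
  linarith [le_abs_self (condNumber (Matrix.vandermonde (ζ n))), Real.norm_eq_abs
    (condNumber (Matrix.vandermonde (ζ n)))]
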